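/- Let $A_1,A_2$ be unital $C^*$-algebras and let $\theta_i$ be a $\mathbb Z_2$-grading of $A_i$, i.e. a $*$-automorphism with $\theta_i^2=\mathrm{id}$; write $A_{i,0}=\{a:\theta_i(a)=a\}$ and $A_{i,1}=\{a:\theta_i(a)=-a\}$, so that $A_i=A_{i,0}\oplus A_{i,1}$. The (algebraic) Fermi product $A_1\,Ⓕ\,A_2$ is the algebraic tensor product $A_1\odot A_2$ with the $*$-algebra structure determined by $$(a\otimes b)(a'\otimes b')=(-1)^{jk}\,aa'\otimes bb',\qquad (a\otimes b)^*=(-1)^{ij}\,a^*\otimes b^*$$ for $a\in A_{1,i}$, $b\in A_{2,j}$, $a'\in A_{1,k}$, $b'\in A_{2,l}$ ($i,j,k,l\in\{0,1\}$). A state $\omega$ of $A_i$ is even if $\omega\circ\theta_i=\omega$. For states $\omega_1$ of $A_1$ and $\omega_2$ of $A_2$, let $\omega_1\times\omega_2$ be the linear functional on $A_1\,Ⓕ\,A_2$ with $(\omega_1\times\omega_2)(a\otimes b)=\omega_1(a)\omega_2(b)$. If $\omega_1$ and $\omega_2$ are even, then $\omega_1\times\omega_2$ is a state (unital, and nonnegative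 on all $x^*x$), and it has a GNS representation $\pi_{\omega_1\times\omega_2}$ by bounded operators, i.e. a $*$-representation on a Hilbert space with a cyclic vector $\xi$ such that $(\omega_1\times\omega_2)(x)=\langle\xi,\pi_{\omega_1\times\omega_2}(x)\xi\rangle$ for all $x$. For every $x\in A_1\,Ⓕ\,A_2$ the supremum $$\|x\|_{\min}:=\sup\{\|\pi_{\omega_1\times\omega_2}(x)\| : \omega_1,\omega_2 \text{ even states of } A_1,A_2\}$$ is finite (it is read as $0$ if there are no states, i.e. if $A_1$ or $A_2$ is zero), and $\|\cdot\|_{\min}$ is a $C^*$-norm on $A_1\,Ⓕ\,A_2$: it is a norm on this complex vector space (in particular $\|x\|_{\min}=0$ only for $x=0$), and $\|xy\|_{\min}\le\|x\|_{\min}\|y\|_{\min}$ and $\|x^*x\|_{\min}=\|x\|_{\min}^2$ for all $x,y$. -/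

import Mathlib

open scoped TensorProduct ComplexOrder DirectSum

universe u v w

noncomputable section

/-- A `ℤ₂`-grading of a unital `*`-algebra, given by an involutive `*`-automorphism. -/
structure Z2Grading (A : Type u) [Ring A] [StarRing A] [Algebra ℂ A] where
  θ : A ≃⋆ₐ[ℂ] A
  involutive : ∀ a, θ (θ a) = a

namespace Z2Grading

variable {A : Type u} [Ring A] [StarRing A] [Algebra ℂ A] (g : Z2Grading A)

/-- The homogeneous components: `part 0` is the even part `{a | θ a = a}`, and `part 1` is the odd
part `{a | θ a = -a}`. -/
def part (i : ZMod 2) : Submodule ℂ A where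
  carrier := {a | g.θ a = (-1 : ℤˣ) ^ i • a}
  add_mem' {a b} ha hb := by
    simp only [Set.mem_ofPred_eq] at *
    rw [map_add, ha, hb, smul_add]
  zero_mem' := by simp
  smul_mem' c a ha := by
    simp only [Set.mem_ofPred_eq] at *
    rw [map_smul, ha, smul_comm]

theorem mem_part {i : ZMod 2} {a : A} : a ∈ g.part i ↔ g.θ a = (-1 : ℤˣ) ^ i • a := Iff.rfl

theorem mem_part_zero {a : A} : a ∈ g.part 0 ↔ g.θ a = a := by
  rw [mem_part]; simp

theorem mem_part_one {a : A} : a ∈ g.part 1 ↔ g.θ a = -a := by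
  rw [mem_part]; simp

instance gradedMonoid : SetLike.GradedMonoid g.part where
  one_mem := by rw [mem_part_zero]; simp
  mul_mem i j a b ha hb := by
    rw [mem_part] at *
    rw [map_mul, ha, hb, uzpow_add, smul_mul_smul_comm]

/-- The projection `(id ± θ) / 2` onto a homogeneous component. -/
def proj (i : ZMod 2) : A →ₗ[ℂ] g.part i where
  toFun a := ⟨(2⁻¹ : ℂ) • (a + (-1 : ℤˣ) ^ i • g.θ a), by
    rw [mem_part, map_smul, map_add, smul_comm ((-1 : ℤˣ) ^ i)]
    congr 1
    rcases Int.units_eq_one_or ((-1 : ℤˣ) ^ i) with h | h <;>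
      simp [h, g.involutive, add_comm, Units.smul_def]⟩
  map_add' a b := by
    ext
    simp only [map_add, smul_add, Submodule.coe_add]
    abel
  map_smul' c a := by
    ext
    simp only [map_smul, RingHom.id_apply, Submodule.coe_smul]
    rw [smul_comm _ c, ← smul_add, smul_comm]

theorem coe_proj (i : ZMod 2) (a : A) :
    (g.proj i a : A) = (2⁻¹ : ℂ) • (a + (-1 : ℤˣ) ^ i • g.θ a) := rfl

theorem proj_add_proj (a : A) : (g.proj 0 a : A) + g.proj 1 a = a := by
  rw [coe_proj, coe_proj, ← smul_add]
  simp only [uzpow_zero, uzpow_one, one_smul, Units.smul_def, Units.val_neg, Units.val_one,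
    neg_smul]
  rw [show a + g.θ a + (a + -g.θ a) = (2 : ℂ) • a by rw [two_smul]; abel, smul_smul]
  norm_num

theorem proj_same {i : ZMod 2} (a : g.part i) : g.proj i (a : A) = a := by
  ext
  rw [coe_proj, (g.mem_part).1 a.2, smul_smul, Int.units_mul_self, one_smul, ← two_smul ℂ,
    smul_smul]
  norm_num

theorem proj_ne {i j : ZMod 2} (h : i ≠ j) (a : g.part i) : g.proj j (a : A) = 0 := by
  ext
  rw [coe_proj, (g.mem_part).1 a.2]
  have h2 : j = i + 1 := (by decide : ∀ i j : ZMod 2, i ≠ j → j = i + 1) i j h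
  subst h2
  rw [smul_smul, uzpow_add, uzpow_one, mul_assoc, mul_comm (-1 : ℤˣ), ← mul_assoc,
    Int.units_mul_self]
  simp [Units.smul_def]

/-- The decomposition `a = a₊ + a₋`. -/
instance gradedAlgebra : GradedAlgebra g.part where
  decompose' a := DirectSum.of (fun i => g.part i) 0 (g.proj 0 a) +
    DirectSum.of (fun i => g.part i) 1 (g.proj 1 a)
  left_inv a := by
    rw [map_add, DirectSum.coeAddMonoidHom_of, DirectSum.coeAddMonoidHom_of]
    exact g.proj_add_proj a
  right_inv x := by
    induction x using DirectSum.induction_on with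
    | zero => simp
    | of i a =>
      rw [DirectSum.coeAddMonoidHom_of]
      have hi : i = 0 ∨ i = 1 := (by decide : ∀ i : ZMod 2, i = 0 ∨ i = 1) i
      rcases hi with rfl | rfl
      · beta_reduce; rw [proj_same, proj_ne _ (by decide)]; simp
      · beta_reduce; rw [proj_same, proj_ne _ (by decide)]; simp
    | add x y hx hy =>
      refine Eq.trans ?_ (congrArg₂ (· + ·) hx hy)
      simp only [map_add]
      abel

theorem star_mem {i : ZMod 2} {a : A} (h : a ∈ g.part i) :
    star a ∈ g.part i := by
  rw [mem_part] at *
  rw [map_star, h, Units.smul_def, Units.smul_def, star_zsmul]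

end Z2Grading

section Fermi

variable {A₁ : Type u} {A₂ : Type v} [Ring A₁] [StarRing A₁] [Algebra ℂ A₁]
  [Ring A₂] [StarRing A₂] [Algebra ℂ A₂]

/-- The algebraic Fermi product: the vector space `A₁ ⊗ A₂` with the multiplication
`(a ⊗ b) (a' ⊗ b') = (-1) ^ (∂b ∂a') • (a a' ⊗ b b')` on homogeneous elements. -/
abbrev FermiProduct (g₁ : Z2Grading A₁) (g₂ : Z2Grading A₂) : Type (max u v) :=
  g₁.part ᵍ⊗[ℂ] g₂.part

namespace FermiProduct

variable (g₁ : Z2Grading A₁) (g₂ : Z2Grading A₂)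

/-- The linear map acting on `A₁,i ⊗ A₂,j` as multiplication by the sign `(-1) ^ (i j)`. -/
def signMap : A₁ ⊗[ℂ] A₂ →ₗ[ℂ] A₁ ⊗[ℂ] A₂ :=
  ∑ i : ZMod 2, ∑ j : ZMod 2, (((-1 : ℤˣ) ^ (i * j) : ℤˣ) : ℤ) •
    TensorProduct.map ((g₁.part i).subtype ∘ₗ g₁.proj i) ((g₂.part j).subtype ∘ₗ g₂.proj j)

theorem signMap_tmul {i j : ZMod 2} (a : g₁.part i) (b : g₂.part j) :
    signMap g₁ g₂ ((a : A₁) ⊗ₜ (b : A₂)) = (-1 : ℤˣ) ^ (i * j) • ((a : A₁) ⊗ₜ[ℂ] (b : A₂)) := by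
  simp only [signMap, LinearMap.sum_apply, LinearMap.smul_apply, TensorProduct.map_tmul,
    LinearMap.comp_apply, Submodule.subtype_apply]
  rw [Finset.sum_eq_single i, Finset.sum_eq_single j]
  · rw [g₁.proj_same, g₂.proj_same]; rfl
  · intro j' _ hj
    rw [g₂.proj_ne hj.symm]; simp
  · simp
  · intro i' _ hi
    rw [g₁.proj_ne hi.symm]; simp
  · simp

variable {g₁ g₂} in
/-- Induction on sums of elementary tensors of homogeneous elements. -/
theorem induction_homogeneous {P : FermiProduct g₁ g₂ → Prop} (x : FermiProduct g₁ g₂)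
    (zero : P 0)
    (tmul : ∀ (i j : ZMod 2) (a : g₁.part i) (b : g₂.part j), P ((a : A₁) ᵍ⊗ₜ[ℂ] (b : A₂)))
    (add : ∀ x y, P x → P y → P (x + y)) : P x := by
  have key : ∀ t : A₁ ⊗[ℂ] A₂, P (GradedTensorProduct.of ℂ g₁.part g₂.part t) := by
    intro t
    induction t using TensorProduct.induction_on with
    | zero => simpa using zero
    | tmul a b =>
      rw [← g₁.proj_add_proj a, ← g₂.proj_add_proj b]
      simp only [TensorProduct.add_tmul, TensorProduct.tmul_add, map_add]
      exact add _ _ (add _ _ (tmul _ _ _ _) (tmul _ _ _ _))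
        (add _ _ (tmul _ _ _ _) (tmul _ _ _ _))
    | add x y hx hy => rw [map_add]; exact add _ _ hx hy
  exact key ((GradedTensorProduct.of ℂ g₁.part g₂.part).symm x)

variable [StarModule ℂ A₁] [StarModule ℂ A₂]

/-- The involution `x* = ∑ i j, (-1) ^ (i j) • (x i j)*`, where `(a ⊗ b)* = a* ⊗ b*` on the right
hand side. -/
instance instStar : Star (FermiProduct g₁ g₂) where
  star x := GradedTensorProduct.of ℂ g₁.part g₂.part
    (signMap g₁ g₂ (star ((GradedTensorProduct.of ℂ g₁.part g₂.part).symm x)))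

variable {g₁ g₂} in
theorem star_tmul {i j : ZMod 2} (a : g₁.part i) (b : g₂.part j) :
    star ((a : A₁) ᵍ⊗ₜ[ℂ] (b : A₂) : FermiProduct g₁ g₂) =
      (-1 : ℤˣ) ^ (i * j) • (star (a : A₁) ᵍ⊗ₜ[ℂ] star (b : A₂)) :=
  signMap_tmul g₁ g₂ ⟨_, g₁.star_mem a.2⟩ ⟨_, g₂.star_mem b.2⟩

variable {g₁ g₂} in
theorem star_add' (x y : FermiProduct g₁ g₂) : star (x + y) = star x + star y := by
  simp only [star, map_add]

theorem star_units_smul (e : ℤˣ) (x : FermiProduct g₁ g₂) : star (e • x) = e • star x := by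
  have hneg : star (-x) = -star x := by simp only [star, map_neg]
  rcases Int.units_eq_one_or e with rfl | rfl
  · simp
  · simpa [Units.smul_def] using hneg

/-- The Fermi product is a unital `*`-algebra. -/
instance instStarRing : StarRing (FermiProduct g₁ g₂) where
  star_add := star_add'
  star_involutive x := by
    induction x using induction_homogeneous with
    | zero => simp [star]
    | tmul i j a b =>
      rw [star_tmul, star_units_smul,
        star_tmul ⟨_, g₁.star_mem a.2⟩ ⟨_, g₂.star_mem b.2⟩, smul_smul, Int.units_mul_self,
        one_smul, star_star, star_star]
    | add x y hx hy => rw [star_add', star_add', hx, hy]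
  star_mul x y := by
    induction x using induction_homogeneous with
    | zero => simp [star]
    | add x x' hx hx' => rw [add_mul, star_add', star_add', hx, hx', mul_add]
    | tmul i j a b =>
      induction y using induction_homogeneous with
      | zero => simp [star]
      | add y y' hy hy' => rw [mul_add, star_add', star_add', hy, hy', add_mul]
      | tmul k l c d =>
        rw [GradedTensorProduct.tmul_coe_mul_coe_tmul, star_units_smul,
          star_tmul ⟨_, SetLike.mul_mem_graded a.2 c.2⟩ ⟨_, SetLike.mul_mem_graded b.2 d.2⟩,
          star_tmul, star_tmul, smul_mul_smul_comm,
          GradedTensorProduct.tmul_coe_mul_coe_tmul g₁.part g₂.part (star (c : A₁))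
            ⟨_, g₂.star_mem d.2⟩ ⟨_, g₁.star_mem a.2⟩ (star (b : A₂)), smul_smul, smul_smul,
          star_mul, star_mul]
        congr 1
        exact (by decide : ∀ i j k l : ZMod 2,
          (-1 : ℤˣ) ^ (j * k) * (-1) ^ ((i + k) * (j + l)) =
            (-1) ^ (k * l) * (-1) ^ (i * j) * (-1) ^ (l * i)) i j k l

instance instStarModule : StarModule ℂ (FermiProduct g₁ g₂) where
  star_smul c x := by
    have h : star (c • (GradedTensorProduct.of ℂ g₁.part g₂.part).symm x) =
        star c • star ((GradedTensorProduct.of ℂ g₁.part g₂.part).symm x) := star_smul _ _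
    change GradedTensorProduct.of ℂ g₁.part g₂.part (signMap g₁ g₂
      (star (c • (GradedTensorProduct.of ℂ g₁.part g₂.part).symm x))) = _
    rw [h, map_smul, map_smul]
    rfl

end FermiProduct

end Fermi

section States

variable {B : Type w} [Ring B] [StarRing B] [Algebra ℂ B]

/-- A state on a unital `*`-algebra: a unital linear functional, positive on the elements
`b* b`. -/
structure IsState (φ : B →ₗ[ℂ] ℂ) : Prop where
  map_one : φ 1 = 1
  nonneg : ∀ b, 0 ≤ φ (star b * b)

/-- An even state of a `ℤ₂`-graded `*`-algebra: a state that is invariant under the grading. -/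
structure IsEvenState (g : Z2Grading B) (φ : B →ₗ[ℂ] ℂ) : Prop extends IsState φ where
  even : ∀ b, φ (g.θ b) = φ b

/-- A GNS representation of a functional `φ` on a unital `*`-algebra: a `*`-representation `π` by
bounded operators on a Hilbert space, with a cyclic vector `ξ` such that `φ b = ⟪ξ, π b ξ⟫`. It is
unique up to unitary equivalence. -/
structure GNSRepresentation (φ : B →ₗ[ℂ] ℂ) where
  H : Type w
  [normedAddCommGroup : NormedAddCommGroup H]
  [innerProductSpace : InnerProductSpace ℂ H]
  [completeSpace : CompleteSpace H]
  π : B →⋆ₐ[ℂ] (H →L[ℂ] H)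
  ξ : H
  cyclic : Dense (Set.range fun b => π b ξ)
  apply_eq : ∀ b, φ b = inner ℂ ξ (π b ξ)

attribute [instance] GNSRepresentation.normedAddCommGroup GNSRepresentation.innerProductSpace
  GNSRepresentation.completeSpace

/-- A C*-norm on a `*`-algebra. -/
structure IsCStarNorm (p : B → ℝ) : Prop where
  nonneg : ∀ x, 0 ≤ p x
  add_le : ∀ x y, p (x + y) ≤ p x + p y
  smul_eq : ∀ (c : ℂ) x, p (c • x) = ‖c‖ * p x
  mul_le : ∀ x y, p (x * y) ≤ p x * p y
  star_mul_self : ∀ x, p (star x * x) = p x ^ 2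
  eq_zero : ∀ x, p x = 0 → x = 0

end States

namespace FermiProduct

variable {A₁ : Type u} {A₂ : Type v} [CStarAlgebra A₁] [CStarAlgebra A₂]
  (g₁ : Z2Grading A₁) (g₂ : Z2Grading A₂)

/-- The product functional `ω₁ × ω₂`, with `(ω₁ × ω₂) (a ⊗ b) = ω₁ a * ω₂ b`. -/
def prodFunctional (ω₁ : A₁ →ₗ[ℂ] ℂ) (ω₂ : A₂ →ₗ[ℂ] ℂ) : FermiProduct g₁ g₂ →ₗ[ℂ] ℂ :=
  LinearMap.mul' ℂ ℂ ∘ₗ TensorProduct.map ω₁ ω₂ ∘ₗ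
    (GradedTensorProduct.of ℂ g₁.part g₂.part).symm.toLinearMap

/-- The numbers `‖π x‖`, with `π` the GNS representation of a product of even states. -/
def spatialValues (x : FermiProduct g₁ g₂) : Set ℝ :=
  {r | ∃ (ω₁ : A₁ →ₗ[ℂ] ℂ) (ω₂ : A₂ →ₗ[ℂ] ℂ), IsEvenState g₁ ω₁ ∧ IsEvenState g₂ ω₂ ∧
    ∃ ρ : GNSRepresentation (prodFunctional g₁ g₂ ω₁ ω₂), r = ‖ρ.π x‖}

/-- The spatial (semi)norm `‖x‖_min`. -/
def spatialNorm (x : FermiProduct g₁ g₂) : ℝ := sSup (spatialValues g₁ g₂ x)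

end FermiProduct

end

/-! The sign in `x* y` for x = a ⊗ b, y = c ⊗ d is governed by the degrees of a, b, c. It cancels
when a and c have equal degree; otherwise a* c is odd and an even ω₁ kills it. Hence (ω₁ × ω₂)(x* y)
is the value in the ordinary tensor product (`prodFunctional_star_mul`), and positivity follows from
the Schur product theorem for Gram matrices.

Since a ⊗ b = (a ⊗ 1)(1 ⊗ b) and both factors are images of C*-algebras, left multiplications are
bounded on the pre-Hilbert space of a state, so GNS representations exist. Also ‖π(a ⊗ b)‖ ≤ ‖a‖‖b‖
in every one of them, so the supremum is finite. The seminorm properties and the C*-identity pass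
from operator norms to the supremum.

For definiteness, averaging a state with its θ-translate shows that even states separate points. If
every π(x) is zero, then every ω₁(c ·) ⊗ ω₂(d ·) kills x, and slicing one factor at a time gives x =
0 (`eq_zero_of_forall_map_mul`). -/

noncomputable section

/-! ### States on *-algebras and the GNS construction -/

section States

variable {B : Type w} [Ring B] [StarRing B] [Algebra ℂ B] [StarModule ℂ B]

theorem IsState.map_star {φ : B →ₗ[ℂ] ℂ} (h : IsState φ) (b : B) : φ (star b) = star (φ b) := by
  -- Polarization: the cross terms at 1 + b and 1 + ib have zero imaginary part, which fixes both
  -- parts of φ(b*).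
  have h1 := (Complex.le_def.1 (h.nonneg (1 + b))).2
  have h2 := (Complex.le_def.1 (h.nonneg (1 + Complex.I • b))).2
  have h3 := (Complex.le_def.1 (h.nonneg b)).2
  simp only [star_add, star_one, add_mul, mul_add, one_mul, mul_one, map_add, h.map_one,
    star_smul, smul_mul_smul_comm, map_smul, Complex.add_im, Complex.zero_im, Complex.one_im,
    smul_eq_mul, Complex.mul_im, Complex.mul_re, Complex.I_re, Complex.I_im, Complex.star_def,
    Complex.conj_I, Complex.neg_re, Complex.neg_im] at h1 h2 h3
  apply Complex.ext
  · simp only [Complex.star_def, Complex.conj_re]; linarith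
  · simp only [Complex.star_def, Complex.conj_im]; linarith

/-- The quadratic form at x is φ(s* s) with s = ∑ xᵢ aᵢ. -/
theorem IsState.posSemidef_gram {φ : B →ₗ[ℂ] ℂ} (h : IsState φ) {ι : Type*} [Fintype ι]
    (a : ι → B) : (Matrix.of fun i j => φ (star (a i) * a j)).PosSemidef := by
  refine Matrix.posSemidef_iff_dotProduct_mulVec.2 ⟨?_, fun x => ?_⟩
  · ext i j
    simp [Matrix.conjTranspose_apply, ← h.map_star]
  · refine (h.nonneg (∑ i, x i • a i)).trans_eq ?_
    simp only [star_sum, star_smul, Finset.sum_mul, Finset.mul_sum, map_sum, dotProduct,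
      Matrix.mulVec, Matrix.of_apply, Pi.star_apply, smul_mul_smul_comm, map_smul, smul_eq_mul]
    refine Finset.sum_comm.trans
      (Finset.sum_congr rfl fun i _ => Finset.sum_congr rfl fun j _ => ?_)
    ring

/-- A `*`-algebra, regarded as the pre-Hilbert space of a state. -/
def PreGNSSpace {φ : B →ₗ[ℂ] ℂ} (_ : IsState φ) : Type w := B

namespace PreGNSSpace

variable {φ : B →ₗ[ℂ] ℂ} (h : IsState φ)

instance : AddCommGroup (PreGNSSpace h) := inferInstanceAs (AddCommGroup B)

instance : Module ℂ (PreGNSSpace h) := inferInstanceAs (Module ℂ B)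

/-- The identity map from the algebra to the pre-Hilbert space. -/
def of : B ≃ₗ[ℂ] PreGNSSpace h := LinearEquiv.refl ℂ _

/-- The semi-inner product `⟪a, b⟫ = φ (a* b)`. -/
abbrev core : PreInnerProductSpace.Core ℂ (PreGNSSpace h) where
  inner a b := φ (star ((of h).symm a) * (of h).symm b)
  conj_inner_symm a b := by
    rw [← Complex.star_def, ← h.map_star, star_mul, star_star]
  re_inner_nonneg a := (Complex.le_def.1 (h.nonneg ((of h).symm a))).1
  add_left a b c := by rw [map_add, star_add, add_mul, map_add]
  smul_left a b c := by simp

instance : SeminormedAddCommGroup (PreGNSSpace h) :=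
  InnerProductSpace.Core.toSeminormedAddCommGroup (c := core h)

instance : InnerProductSpace ℂ (PreGNSSpace h) := InnerProductSpace.ofCore (core h)

theorem inner_of (a b : B) : inner ℂ (of h a) (of h b) = φ (star a * b) := rfl

theorem norm_of_sq (a : B) : ‖of h a‖ ^ 2 = (φ (star a * a)).re := by
  rw [@norm_sq_eq_re_inner ℂ, inner_of]; rfl

/-- Left multiplication, as an operator on the pre-Hilbert space of the state. -/
def leftMul (hb : ∀ y, ∃ C, ∀ x, ‖of h (y * x)‖ ≤ C * ‖of h x‖) (y : B) :
    PreGNSSpace h →L[ℂ] PreGNSSpace h :=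
  ((of h).toLinearMap ∘ₗ LinearMap.mulLeft ℂ y ∘ₗ (of h).symm.toLinearMap).mkContinuous
    (hb y).choose fun x => (hb y).choose_spec ((of h).symm x)

/-- The `*`-representation by left multiplication on the Hilbert space of the state. -/
def rep (hb : ∀ y, ∃ C, ∀ x, ‖of h (y * x)‖ ≤ C * ‖of h x‖) :
    B →⋆ₐ[ℂ] (UniformSpace.Completion (PreGNSSpace h) →L[ℂ]
      UniformSpace.Completion (PreGNSSpace h)) :=
  have key : ∀ (y : B) (x : PreGNSSpace h),
      (leftMul h hb y).completion (x : UniformSpace.Completion (PreGNSSpace h)) =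
        ((of h (y * (of h).symm x) : PreGNSSpace h) : UniformSpace.Completion (PreGNSSpace h)) :=
    fun y x => ContinuousLinearMap.completion_apply_coe _ _
  -- Density: operator identities need checking only on the image of the algebra.
  have ext : ∀ {f g : UniformSpace.Completion (PreGNSSpace h) →L[ℂ]
      UniformSpace.Completion (PreGNSSpace h)},
      (∀ x : PreGNSSpace h, f x = g x) → f = g := fun {f g} hfg =>
    ContinuousLinearMap.ext fun x => UniformSpace.Completion.induction_on x
      (isClosed_eq f.continuous g.continuous) hfg
  have smul : ∀ (c : ℂ) (y : B),
      (leftMul h hb (c • y)).completion = c • (leftMul h hb y).completion := fun c y =>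
    ext fun x => by
      rw [key, _root_.smul_apply, key, smul_mul_assoc, map_smul,
        UniformSpace.Completion.coe_smul]
  have one : (leftMul h hb 1).completion = 1 := ext fun x => by
    rw [key, one_mul]; rfl
  { toFun := fun y => (leftMul h hb y).completion
    map_one' := one
    map_mul' := fun y z => ext fun x => by
      rw [key, mul_apply_eq_comp, key, key, LinearEquiv.symm_apply_apply, mul_assoc]
    map_zero' := by simpa using smul 0 0
    map_add' := fun y z => ext fun x => by
      rw [key, _root_.add_apply, key, key, add_mul, map_add,
        UniformSpace.Completion.coe_add]
    commutes' := fun c => by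
      rw [Algebra.algebraMap_eq_smul_one, Algebra.algebraMap_eq_smul_one, smul, one]
    map_star' := fun y => by
      refine (ContinuousLinearMap.eq_adjoint_iff _ _).2 fun x z => ?_
      induction x, z using UniformSpace.Completion.induction_on₂ with
      | hp => apply isClosed_eq <;> fun_prop
      | ih x z =>
        rw [key, key, UniformSpace.Completion.inner_coe, UniformSpace.Completion.inner_coe]
        change φ (star (star y * (of h).symm x) * (of h).symm z) =
          φ (star ((of h).symm x) * (y * (of h).symm z))
        rw [star_mul, star_star, mul_assoc] }

theorem rep_coe (hb : ∀ y, ∃ C, ∀ x, ‖of h (y * x)‖ ≤ C * ‖of h x‖) (y x : B) :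
    rep h hb y (of h x : PreGNSSpace h) = (of h (y * x) : PreGNSSpace h) :=
  ContinuousLinearMap.completion_apply_coe _ _

/-- The GNS representation of a state for which all left multiplications are bounded. -/
def gns (hb : ∀ y, ∃ C, ∀ x, ‖of h (y * x)‖ ≤ C * ‖of h x‖) : GNSRepresentation φ where
  H := UniformSpace.Completion (PreGNSSpace h)
  π := rep h hb
  ξ := (of h 1 : PreGNSSpace h)
  cyclic := by
    have hr : (Set.range fun b => rep h hb b (of h 1 : PreGNSSpace h)) =
        Set.range ((↑) : PreGNSSpace h → UniformSpace.Completion (PreGNSSpace h)) := by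
      ext z
      constructor
      · rintro ⟨b, rfl⟩
        exact ⟨of h (b * 1), (rep_coe h hb b 1).symm⟩
      · rintro ⟨b, rfl⟩
        exact ⟨(of h).symm b, (rep_coe h hb _ 1).trans (by rw [mul_one]; rfl)⟩
    rw [hr]
    exact UniformSpace.Completion.denseRange_coe
  apply_eq b := by
    rw [rep_coe, UniformSpace.Completion.inner_coe, inner_of, mul_one, star_one, one_mul]

/-- Left multiplication by an element of a C⋆-algebra that acts on `B` by a `*`-homomorphism is
bounded by its norm. -/
theorem norm_of_map_mul_le {A : Type*} [CStarAlgebra A] (f : A →⋆ₐ[ℂ] B) (a : A) (x : B) :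
    ‖of h (f a * x)‖ ≤ ‖a‖ * ‖of h x‖ := by
  let _ := CStarAlgebra.spectralOrder A
  let _ := CStarAlgebra.spectralOrderedRing A
  have hle : star a * a ≤ algebraMap ℝ A (‖a‖ ^ 2) := by
    simpa [sq, CStarRing.norm_star_mul_self] using
      IsSelfAdjoint.le_algebraMap_norm_self (a := star a * a) (.star_mul_self a)
  -- Write ‖a‖² − a* a = c* c in the C*-algebra; positivity of φ at f(c)x is then the claimed bound,
  -- squared.
  obtain ⟨c, hc⟩ := CStarAlgebra.nonneg_iff_eq_star_mul_self.1 (sub_nonneg.2 hle)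
  have hpos := (Complex.le_def.1 (h.nonneg (f c * x))).1
  have hEq : star (f c * x) * (f c * x) =
      ((‖a‖ ^ 2 : ℝ) : ℂ) • (star x * x) - star (f a * x) * (f a * x) := by
    have hf : star (f c) * f c = ((‖a‖ ^ 2 : ℝ) : ℂ) • 1 - star (f a) * f a := by
      rw [← map_star, ← map_mul, ← hc, map_sub, map_mul, map_star,
        IsScalarTower.algebraMap_apply ℝ ℂ A, AlgHomClass.commutes, Algebra.algebraMap_eq_smul_one]
      rfl
    calc star (f c * x) * (f c * x) = star x * (star (f c) * f c) * x := by
          rw [star_mul]; simp only [mul_assoc]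
      _ = _ := by
          rw [hf, mul_sub, sub_mul, star_mul]; simp [mul_assoc]
  rw [hEq, map_sub, map_smul, smul_eq_mul, Complex.sub_re, Complex.re_ofReal_mul, Complex.zero_re,
    ← norm_of_sq h, ← norm_of_sq h, ← mul_pow] at hpos
  exact (sq_le_sq₀ (norm_nonneg _) (by positivity)).1 (sub_nonneg.1 hpos)

end PreGNSSpace

end States

/-! ### Separation by states and by even states -/

section Separation

variable {A : Type u} [CStarAlgebra A]

/-- States separate the positive elements from zero. -/
theorem exists_isState_star_mul_self_ne_zero {a : A} (ha : a ≠ 0) :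
    ∃ φ : A →ₗ[ℂ] ℂ, IsState φ ∧ φ (star a * a) ≠ 0 := by
  let _ := CStarAlgebra.spectralOrder A
  let _ := CStarAlgebra.spectralOrderedRing A
  have hnot : -(star a * a) ∉ {b : A | 0 ≤ b} := fun hneg => by
    have h0 : star a * a = 0 := le_antisymm (neg_nonneg.1 hneg) (star_mul_self_nonneg a)
    exact ha (CStarRing.star_mul_self_eq_zero_iff a |>.1 h0)
  have hconv : Convex ℝ {b : A | 0 ≤ b} := fun x hx y hy s t hs ht _ =>
    show 0 ≤ s • x + t • y from add_nonneg (smul_nonneg hs hx) (smul_nonneg ht hy)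
  -- Separate −a* a from the closed positive cone.
  obtain ⟨f, r, hr, hf⟩ := RCLike.geometric_hahn_banach_point_closed (𝕜 := ℂ) hconv
    CStarAlgebra.isClosed_nonneg hnot
  replace hf : ∀ b : A, 0 ≤ b → r < (f b).re := hf
  have hr0 : r < 0 := by simpa using hf 0 le_rfl
  -- If Re f(b) < 0, a positive multiple of b would take the value r itself, against the strict
  -- bound.
  have hpos : ∀ b : A, 0 ≤ b → 0 ≤ (f b).re := fun b hb => by
    by_contra! hlt
    have := hf ((r / (f b).re) • b) (smul_nonneg (div_nonneg_of_nonpos hr0.le hlt.le) hb)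
    rw [← Complex.coe_smul, map_smul] at this
    simp [div_mul_cancel₀ _ hlt.ne] at this
  -- The Hermitian part of f, which equals Re f on positive elements.
  let ψ : A →ₗ[ℂ] ℂ :=
    { toFun := fun b => (2⁻¹ : ℂ) * (f b + star (f (star b)))
      map_add' := fun b c => by simp only [map_add, star_add]; ring
      map_smul' := fun c b => by
        simp only [map_smul, star_smul, smul_eq_mul, star_mul', star_star, RingHom.id_apply]; ring }
  have hψ : ∀ b : A, ψ (star b * b) = ((f (star b * b)).re : ℂ) := fun b => by
    change (2⁻¹ : ℂ) * (f (star b * b) + star (f (star (star b * b)))) = _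
    rw [star_mul, star_star, Complex.star_def, Complex.add_conj]
    simp
  have hψa : 0 < (f (star a * a)).re := by
    have : (f (-(star a * a))).re < 0 := lt_trans hr hr0
    simpa using this
  have hψ1 : ψ 1 = ((f 1).re : ℂ) := by simpa using hψ 1
  -- Normalization is possible: a* a ≤ ‖a* a‖·1, so Re f(1) = 0 would force Re f(a* a) ≤ 0.
  have h1 : 0 < (f 1).re := by
    refine lt_of_le_of_ne (hpos 1 zero_le_one) fun h0 => ?_
    have hle := hpos _ (sub_nonneg.2 (IsSelfAdjoint.le_algebraMap_norm_self (a := star a * a)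
      (.star_mul_self a)))
    rw [map_sub, IsScalarTower.algebraMap_apply ℝ ℂ A, Algebra.algebraMap_eq_smul_one,
      map_smul] at hle
    simp [← h0] at hle
    linarith
  refine ⟨((f 1).re : ℂ)⁻¹ • ψ, ⟨?_, fun b => ?_⟩, ?_⟩
  · rw [LinearMap.smul_apply, hψ1, smul_eq_mul, inv_mul_cancel₀]
    exact_mod_cast h1.ne'
  · rw [LinearMap.smul_apply, hψ, smul_eq_mul]
    have := hpos _ (star_mul_self_nonneg b)
    rw [← Complex.ofReal_inv, ← Complex.ofReal_mul]
    exact_mod_cast mul_nonneg (inv_nonneg.2 h1.le) this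
  · rw [LinearMap.smul_apply, hψ, smul_eq_mul]
    exact mul_ne_zero (inv_ne_zero (by exact_mod_cast h1.ne')) (by exact_mod_cast hψa.ne')

/-- Even states separate the positive elements from zero. -/
theorem eq_zero_of_forall_isEvenState (g : Z2Grading A) {a : A}
    (h : ∀ φ, IsEvenState g φ → φ (star a * a) = 0) : a = 0 := by
  by_contra ha
  obtain ⟨ψ, hψ, hne⟩ := exists_isState_star_mul_self_ne_zero ha
  have hθ : IsState (ψ ∘ₗ g.θ.toAlgEquiv.toLinearMap) :=
    ⟨by simpa using hψ.map_one, fun b => by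
      simpa [map_star g.θ] using hψ.nonneg (g.θ b)⟩
  refine hne ?_
  -- The average of ψ and ψ ∘ θ is even; if it vanishes at a* a, so do both nonnegative summands.
  have h0 := h ((2⁻¹ : ℂ) • (ψ + ψ ∘ₗ g.θ.toAlgEquiv.toLinearMap))
    { map_one := by
        rw [LinearMap.smul_apply, LinearMap.add_apply, hψ.map_one, hθ.map_one]; norm_num
      nonneg := fun b => by
        rw [LinearMap.smul_apply, LinearMap.add_apply, smul_eq_mul]
        exact mul_nonneg (by norm_num [Complex.le_def]) (add_nonneg (hψ.nonneg b) (hθ.nonneg b))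
      even := fun b => by
        simp [g.involutive, add_comm] }
  rw [LinearMap.smul_apply, LinearMap.add_apply, smul_eq_mul, mul_eq_zero] at h0
  have h1 := h0.resolve_left (by norm_num)
  refine le_antisymm ?_ (hψ.nonneg a)
  rw [eq_neg_of_add_eq_zero_left h1]
  exact neg_nonpos.2 (hθ.nonneg a)

end Separation

/-! ### Positivity of product functionals -/

namespace FermiProduct

section Functional

variable {A₁ : Type u} {A₂ : Type v} [CStarAlgebra A₁] [CStarAlgebra A₂]
  {g₁ : Z2Grading A₁} {g₂ : Z2Grading A₂}

theorem prodFunctional_tmul (ω₁ : A₁ →ₗ[ℂ] ℂ) (ω₂ : A₂ →ₗ[ℂ] ℂ) (a : A₁) (b : A₂) :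
    prodFunctional g₁ g₂ ω₁ ω₂ (a ᵍ⊗ₜ[ℂ] b) = ω₁ a * ω₂ b := rfl

theorem prodFunctional_units_smul (ω₁ : A₁ →ₗ[ℂ] ℂ) (ω₂ : A₂ →ₗ[ℂ] ℂ) (e : ℤˣ)
    (x : FermiProduct g₁ g₂) :
    prodFunctional g₁ g₂ ω₁ ω₂ (e • x) = e • prodFunctional g₁ g₂ ω₁ ω₂ x := by
  rw [Units.smul_def, Units.smul_def, map_zsmul]

theorem _root_.IsEvenState.apply_eq_zero {A : Type u} [CStarAlgebra A] {g : Z2Grading A}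
    {ω : A →ₗ[ℂ] ℂ} (h : IsEvenState g ω) {a : A} (ha : a ∈ g.part 1) : ω a = 0 := by
  have h1 := h.even a
  rw [g.mem_part_one.1 ha, map_neg] at h1
  exact self_eq_neg.1 h1.symm

/-- If `ω₁` is even, then `ω₁ × ω₂` does not see the signs in the Fermi product `x* y`. -/
theorem prodFunctional_star_mul {ω₁ : A₁ →ₗ[ℂ] ℂ} (h₁ : IsEvenState g₁ ω₁) (ω₂ : A₂ →ₗ[ℂ] ℂ)
    (x y : FermiProduct g₁ g₂) :
    prodFunctional g₁ g₂ ω₁ ω₂ (star x * y) =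
      LinearMap.mul' ℂ ℂ (TensorProduct.map ω₁ ω₂
        (star ((GradedTensorProduct.of ℂ g₁.part g₂.part).symm x) *
          (GradedTensorProduct.of ℂ g₁.part g₂.part).symm y)) := by
  induction x using induction_homogeneous with
  | zero => simp
  | add x x' hx hx' => simp only [star_add, add_mul, map_add, hx, hx']
  | tmul i j a b =>
    induction y using induction_homogeneous with
    | zero => simp
    | add y y' hy hy' => simp only [mul_add, map_add, hy, hy']
    | tmul k l c d =>
      rw [star_tmul, smul_mul_assoc, GradedTensorProduct.tmul_coe_mul_coe_tmul g₁.part g₂.part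
        (star (a : A₁)) ⟨_, g₂.star_mem b.2⟩ c (d : A₂), smul_smul, prodFunctional_units_smul,
        prodFunctional_tmul, GradedTensorProduct.of_symm_of, GradedTensorProduct.of_symm_of,
        TensorProduct.star_tmul, Algebra.TensorProduct.tmul_mul_tmul, TensorProduct.map_tmul,
        LinearMap.mul'_apply]
      by_cases hik : i = k
      · subst hik
        rw [mul_comm j i, Int.units_mul_self, one_smul]
      · have hdeg : i + k = 1 := (by decide : ∀ i k : ZMod 2, i ≠ k → i + k = 1) i k hik
        have hmem : star (a : A₁) * (c : A₁) ∈ g₁.part 1 :=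
          hdeg ▸ SetLike.mul_mem_graded (g₁.star_mem a.2) c.2
        rw [h₁.apply_eq_zero hmem, zero_mul, smul_zero]

theorem isState_prodFunctional {ω₁ : A₁ →ₗ[ℂ] ℂ} {ω₂ : A₂ →ₗ[ℂ] ℂ} (h₁ : IsEvenState g₁ ω₁)
    (h₂ : IsState ω₂) : IsState (prodFunctional g₁ g₂ ω₁ ω₂) where
  map_one := by
    rw [← GradedTensorProduct.of_one, Algebra.TensorProduct.one_def, prodFunctional_tmul,
      h₁.map_one, h₂.map_one, one_mul]
  nonneg x := by
    rw [prodFunctional_star_mul h₁]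
    obtain ⟨n, a, b, hx⟩ : ∃ (n : ℕ) (a : Fin n → A₁) (b : Fin n → A₂),
        (GradedTensorProduct.of ℂ g₁.part g₂.part).symm x = ∑ i, a i ⊗ₜ[ℂ] b i :=
      TensorProduct.exists_sum_tmul_eq _
    -- Schur product theorem, with the form evaluated at the all-ones vector.
    have hpos := (Matrix.posSemidef_iff_dotProduct_mulVec.1
      ((h₁.toIsState.posSemidef_gram a).hadamard (h₂.posSemidef_gram b))).2 1
    refine hpos.trans_eq ?_
    rw [hx]
    simp only [star_sum, TensorProduct.star_tmul, Finset.sum_mul_sum,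
      Algebra.TensorProduct.tmul_mul_tmul, map_sum, TensorProduct.map_tmul, LinearMap.mul'_apply,
      dotProduct, Matrix.mulVec, Matrix.hadamard_apply, Matrix.of_apply, Pi.star_apply,
      Pi.one_apply, star_one, one_mul, mul_one]

/-! ### Embedded factors and bounded representations -/

variable (g₁ g₂)

/-- The unital `*`-homomorphism `a ↦ a ⊗ 1`. -/
def inl : A₁ →⋆ₐ[ℂ] FermiProduct g₁ g₂ where
  toAlgHom := GradedTensorProduct.includeLeft g₁.part g₂.part
  map_star' a := by
    have h : ∀ (i : ZMod 2) (c : g₁.part i), (star (c : A₁) ᵍ⊗ₜ[ℂ] (1 : A₂) : FermiProduct g₁ g₂) =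
        star ((c : A₁) ᵍ⊗ₜ[ℂ] (1 : A₂)) := fun i c => by
      have := star_tmul c (⟨1, SetLike.one_mem_graded g₂.part⟩ : g₂.part 0)
      simpa using this.symm
    change (star a ᵍ⊗ₜ[ℂ] (1 : A₂) : FermiProduct g₁ g₂) = star (a ᵍ⊗ₜ[ℂ] (1 : A₂))
    rw [← g₁.proj_add_proj a]
    simp only [GradedTensorProduct.tmul, star_add, TensorProduct.add_tmul, map_add] at h ⊢
    rw [h, h]

/-- The unital `*`-homomorphism `b ↦ 1 ⊗ b`. -/
def inr : A₂ →⋆ₐ[ℂ] FermiProduct g₁ g₂ where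
  toAlgHom := GradedTensorProduct.includeRight g₁.part g₂.part
  map_star' b := by
    have h : ∀ (j : ZMod 2) (c : g₂.part j), ((1 : A₁) ᵍ⊗ₜ[ℂ] star (c : A₂) : FermiProduct g₁ g₂) =
        star ((1 : A₁) ᵍ⊗ₜ[ℂ] (c : A₂)) := fun j c => by
      have := star_tmul (⟨1, SetLike.one_mem_graded g₁.part⟩ : g₁.part 0) c
      simpa using this.symm
    change ((1 : A₁) ᵍ⊗ₜ[ℂ] star b : FermiProduct g₁ g₂) = star ((1 : A₁) ᵍ⊗ₜ[ℂ] b)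
    rw [← g₂.proj_add_proj b]
    simp only [GradedTensorProduct.tmul, star_add, TensorProduct.tmul_add, map_add] at h ⊢
    rw [h, h]

theorem inl_mul_inr (a : A₁) (b : A₂) :
    inl g₁ g₂ a * inr g₁ g₂ b = (a ᵍ⊗ₜ[ℂ] b : FermiProduct g₁ g₂) :=
  GradedTensorProduct.tmul_one_mul_one_tmul g₁.part g₂.part a b

variable {g₁ g₂}

/-- Boundedness of left multiplication is additive, and on a ⊗ b it follows from
`norm_of_map_mul_le` for the two embedded factors. -/
theorem nonempty_gnsRepresentation {φ : FermiProduct g₁ g₂ →ₗ[ℂ] ℂ} (h : IsState φ) :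
    Nonempty (GNSRepresentation φ) := by
  refine ⟨PreGNSSpace.gns h fun y => ?_⟩
  induction y using induction_homogeneous with
  | zero => exact ⟨0, fun x => by simp⟩
  | add y z hy hz =>
    obtain ⟨C, hC⟩ := hy
    obtain ⟨D, hD⟩ := hz
    refine ⟨C + D, fun x => ?_⟩
    rw [add_mul, map_add, add_mul]
    exact (norm_add_le _ _).trans (add_le_add (hC x) (hD x))
  | tmul i j a b =>
    refine ⟨‖(a : A₁)‖ * ‖(b : A₂)‖, fun x => ?_⟩
    rw [← inl_mul_inr, mul_assoc, mul_assoc]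
    exact (PreGNSSpace.norm_of_map_mul_le h (inl g₁ g₂) _ _).trans
      (mul_le_mul_of_nonneg_left (PreGNSSpace.norm_of_map_mul_le h (inr g₁ g₂) _ _)
        (norm_nonneg _))

/-- The norms of `x` in the `*`-representations of the Fermi product are bounded. -/
theorem exists_norm_rep_le (x : FermiProduct g₁ g₂) :
    ∃ C : ℝ, ∀ {φ : FermiProduct g₁ g₂ →ₗ[ℂ] ℂ} (ρ : GNSRepresentation φ), ‖ρ.π x‖ ≤ C := by
  induction x using induction_homogeneous with
  | zero => exact ⟨0, fun ρ => by simp⟩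
  | add y z hy hz =>
    obtain ⟨C, hC⟩ := hy
    obtain ⟨D, hD⟩ := hz
    refine ⟨C + D, fun ρ => ?_⟩
    rw [map_add]
    exact (norm_add_le _ _).trans (add_le_add (hC ρ) (hD ρ))
  | tmul i j a b =>
    refine ⟨‖(a : A₁)‖ * ‖(b : A₂)‖, fun ρ => ?_⟩
    rw [← inl_mul_inr, map_mul]
    -- *-homomorphisms between C*-algebras are contractive.
    exact (norm_mul_le _ _).trans (mul_le_mul
      (NonUnitalStarAlgHom.norm_apply_le (ρ.π.comp (inl g₁ g₂)) (a : A₁))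
      (NonUnitalStarAlgHom.norm_apply_le (ρ.π.comp (inr g₁ g₂)) (b : A₂))
      (norm_nonneg _) (norm_nonneg _))

/-! ### The spatial seminorm -/

theorem bddAbove_spatialValues (x : FermiProduct g₁ g₂) : BddAbove (spatialValues g₁ g₂ x) := by
  obtain ⟨C, hC⟩ := exists_norm_rep_le x
  refine ⟨C, ?_⟩
  rintro r ⟨ω₁, ω₂, -, -, ρ, rfl⟩
  exact hC ρ

theorem norm_rep_le_spatialNorm {ω₁ : A₁ →ₗ[ℂ] ℂ} {ω₂ : A₂ →ₗ[ℂ] ℂ} (h₁ : IsEvenState g₁ ω₁)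
    (h₂ : IsEvenState g₂ ω₂) (ρ : GNSRepresentation (prodFunctional g₁ g₂ ω₁ ω₂))
    (x : FermiProduct g₁ g₂) : ‖ρ.π x‖ ≤ spatialNorm g₁ g₂ x :=
  le_csSup (bddAbove_spatialValues x) ⟨ω₁, ω₂, h₁, h₂, ρ, rfl⟩

/-- Nonnegativity of C covers the case without states, where the supremum is 0. -/
theorem spatialNorm_le {x : FermiProduct g₁ g₂} {C : ℝ} (hC : 0 ≤ C)
    (h : ∀ (ω₁ : A₁ →ₗ[ℂ] ℂ) (ω₂ : A₂ →ₗ[ℂ] ℂ), IsEvenState g₁ ω₁ → IsEvenState g₂ ω₂ →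
      ∀ ρ : GNSRepresentation (prodFunctional g₁ g₂ ω₁ ω₂), ‖ρ.π x‖ ≤ C) :
    spatialNorm g₁ g₂ x ≤ C := by
  refine Real.sSup_le ?_ hC
  rintro r ⟨ω₁, ω₂, h₁, h₂, ρ, rfl⟩
  exact h ω₁ ω₂ h₁ h₂ ρ

theorem spatialNorm_nonneg (x : FermiProduct g₁ g₂) : 0 ≤ spatialNorm g₁ g₂ x := by
  refine Real.sSup_nonneg ?_
  rintro r ⟨ω₁, ω₂, -, -, ρ, rfl⟩
  exact norm_nonneg _

theorem spatialNorm_smul_le (c : ℂ) (x : FermiProduct g₁ g₂) :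
    spatialNorm g₁ g₂ (c • x) ≤ ‖c‖ * spatialNorm g₁ g₂ x :=
  spatialNorm_le (mul_nonneg (norm_nonneg c) (spatialNorm_nonneg x)) fun ω₁ ω₂ h₁ h₂ ρ => by
    rw [map_smul, norm_smul]
    exact mul_le_mul_of_nonneg_left (norm_rep_le_spatialNorm h₁ h₂ ρ x) (norm_nonneg c)

/-! ### Definiteness and the C*-norm -/

/-- The product functionals `ω₁ (c ·) ⊗ ω₂ (d ·)`, with `ω₁` and `ω₂` even states, separate the
points of the algebraic tensor product. -/
theorem eq_zero_of_forall_map_mul (t : A₁ ⊗[ℂ] A₂)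
    (h : ∀ (ω₁ : A₁ →ₗ[ℂ] ℂ) (ω₂ : A₂ →ₗ[ℂ] ℂ), IsEvenState g₁ ω₁ → IsEvenState g₂ ω₂ →
      ∀ c d, LinearMap.mul' ℂ ℂ (TensorProduct.map ω₁ ω₂ ((c ⊗ₜ[ℂ] d) * t)) = 0) : t = 0 := by
  obtain ⟨n, a, b, rfl⟩ := TensorProduct.exists_sum_tmul_eq t
  simp only [Finset.mul_sum, Algebra.TensorProduct.tmul_mul_tmul, map_sum, TensorProduct.map_tmul,
    LinearMap.mul'_apply] at h
  -- Taking d to be the adjoint of this slice r gives ω₂(r* r) = 0 for all even ω₂.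
  have hr : ∀ ω₁ : A₁ →ₗ[ℂ] ℂ, IsEvenState g₁ ω₁ → ∀ c : A₁, ∑ i, ω₁ (c * a i) • b i = 0 :=
    fun ω₁ h₁ c => eq_zero_of_forall_isEvenState g₂ fun ω₂ h₂ => by
      rw [← h ω₁ ω₂ h₁ h₂ c (star (∑ i, ω₁ (c * a i) • b i))]
      generalize star (∑ i, ω₁ (c * a i) • b i) = d
      simp only [Finset.mul_sum, map_sum, mul_smul_comm, map_smul, smul_eq_mul]
  -- Apply f to the vanishing slices and repeat the argument in the first factor.
  have hl : ∀ f : A₂ →ₗ[ℂ] ℂ, ∑ i, f (b i) • a i = 0 := fun f =>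
    eq_zero_of_forall_isEvenState g₁ fun ω₁ h₁ => by
      generalize star (∑ i, f (b i) • a i) = c
      have := congrArg f (hr ω₁ h₁ c)
      simp only [map_sum, map_smul, smul_eq_mul, map_zero] at this
      simp only [Finset.mul_sum, map_sum, mul_smul_comm, map_smul, smul_eq_mul]
      simpa only [mul_comm] using this
  classical
  -- The coordinates of t in a basis of `A₂` are slices by coordinate functionals.
  let 𝓑 := Module.Basis.ofVectorSpace ℂ A₂
  refine (TensorProduct.equivFinsuppOfBasisRight (M := A₁) 𝓑).injective (Finsupp.ext fun k => ?_)
  rw [map_sum, map_zero, Finsupp.finsetSum_apply]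
  simpa [TensorProduct.equivFinsuppOfBasisRight_apply_tmul_apply] using hl (𝓑.coord k)

theorem eq_zero_of_spatialNorm_eq_zero (x : FermiProduct g₁ g₂) (hx : spatialNorm g₁ g₂ x = 0) :
    x = 0 := by
  refine (GradedTensorProduct.of ℂ g₁.part g₂.part).symm.map_eq_zero_iff.1
    (eq_zero_of_forall_map_mul (g₁ := g₁) (g₂ := g₂) _ fun ω₁ ω₂ h₁ h₂ c d => ?_)
  obtain ⟨ρ⟩ := nonempty_gnsRepresentation (isState_prodFunctional h₁ h₂.toIsState)
  have hρ : ρ.π x = 0 :=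
    norm_le_zero_iff.1 ((norm_rep_le_spatialNorm h₁ h₂ ρ x).trans_eq hx)
  have h0 := prodFunctional_star_mul h₁ ω₂ (star c ᵍ⊗ₜ[ℂ] star d) x
  rw [ρ.apply_eq, map_mul, hρ, mul_zero, zero_apply, inner_zero_right,
    GradedTensorProduct.of_symm_of, TensorProduct.star_tmul, star_star, star_star] at h0
  exact h0.symm

theorem isCStarNorm_spatialNorm : IsCStarNorm (spatialNorm g₁ g₂) where
  nonneg := spatialNorm_nonneg
  add_le x y := spatialNorm_le (add_nonneg (spatialNorm_nonneg x) (spatialNorm_nonneg y))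
    fun ω₁ ω₂ h₁ h₂ ρ => by
      rw [map_add]
      exact (norm_add_le _ _).trans (add_le_add (norm_rep_le_spatialNorm h₁ h₂ ρ x)
        (norm_rep_le_spatialNorm h₁ h₂ ρ y))
  smul_eq c x := by
    refine le_antisymm (spatialNorm_smul_le c x) ?_
    rcases eq_or_ne c 0 with rfl | hc
    · rw [norm_zero, zero_mul]
      exact spatialNorm_nonneg _
    · have h := spatialNorm_smul_le c⁻¹ (c • x)
      rw [smul_smul, inv_mul_cancel₀ hc, one_smul, norm_inv] at h
      exact (le_inv_mul_iff₀ (norm_pos_iff.2 hc)).1 h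
  mul_le x y := spatialNorm_le (mul_nonneg (spatialNorm_nonneg x) (spatialNorm_nonneg y))
    fun ω₁ ω₂ h₁ h₂ ρ => by
      rw [map_mul]
      exact (norm_mul_le _ _).trans (mul_le_mul (norm_rep_le_spatialNorm h₁ h₂ ρ x)
        (norm_rep_le_spatialNorm h₁ h₂ ρ y) (norm_nonneg _) (spatialNorm_nonneg x))
  star_mul_self x := by
    refine le_antisymm (spatialNorm_le (sq_nonneg _) fun ω₁ ω₂ h₁ h₂ ρ => ?_) ?_
    · rw [map_mul, map_star, CStarRing.norm_star_mul_self, ← sq]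
      exact pow_le_pow_left₀ (norm_nonneg _) (norm_rep_le_spatialNorm h₁ h₂ ρ x) 2
    -- Square roots turn ‖x‖² ≤ ‖x* x‖ into an upper bound on each ‖π(x)‖.
    · refine (Real.le_sqrt (spatialNorm_nonneg _) (spatialNorm_nonneg _)).1
        (spatialNorm_le (Real.sqrt_nonneg _) fun ω₁ ω₂ h₁ h₂ ρ => Real.le_sqrt_of_sq_le ?_)
      rw [sq, ← CStarRing.norm_star_mul_self, ← map_star, ← map_mul]
      exact norm_rep_le_spatialNorm h₁ h₂ ρ _
  eq_zero := eq_zero_of_spatialNorm_eq_zero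

end Functional

end FermiProduct

end

theorem mainTheorem9 {A₁ : Type u} {A₂ : Type v} [CStarAlgebra A₁] [CStarAlgebra A₂]
    (g₁ : Z2Grading A₁) (g₂ : Z2Grading A₂) :
    (∀ (ω₁ : A₁ →ₗ[ℂ] ℂ) (ω₂ : A₂ →ₗ[ℂ] ℂ), IsEvenState g₁ ω₁ → IsEvenState g₂ ω₂ →
      IsState (FermiProduct.prodFunctional g₁ g₂ ω₁ ω₂) ∧
      Nonempty (GNSRepresentation (FermiProduct.prodFunctional g₁ g₂ ω₁ ω₂))) ∧
    (∀ x : FermiProduct g₁ g₂, BddAbove (FermiProduct.spatialValues g₁ g₂ x)) ∧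
    IsCStarNorm (FermiProduct.spatialNorm g₁ g₂) := by
  exact ⟨fun ω₁ ω₂ h₁ h₂ =>
    have h := FermiProduct.isState_prodFunctional h₁ h₂.toIsState
    ⟨h, FermiProduct.nonempty_gnsRepresentation h⟩,
    FermiProduct.bddAbove_spatialValues, FermiProduct.isCStarNorm_spatialNorm⟩
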